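/- **Notation.** For a real square matrix $A$ of size $d$, let $\mathfrak g_A=\mathbb R e_0\ltimes_A\mathbb R^d$ be the almost abelian Lie algebra with $[e_0,v]=Av$ and $[v,w]=0$ for $v,w\in\mathbb R^d$. A symplectic structure on a real Lie algebra is a non-degenerate alternating bilinear form $\omega$ with $\omega([x,y],z)+\omega([y,z],x)+\omega([z,x],y)=0$ for all $x,y,z$. Let $\operatorname{spec}(A)\subset\mathbb C$ be the set of complex eigenvalues of $A$. For $a\in\mathbb R$, $M(a)$ denotes a real square matrix, of size $m_a\ge 1$, with $\operatorname{spec}(M(a))=\{a\}$. Write $A\oplus B$ for the block diagonal matrix with diagonal blocks $A$ and $B$. For a non-singular skew-symmetric $\Omega\in M(r,\mathbb R)$ put $\mathfrak{sp}_\Omega(r,\mathbb R)=\{D\in M(r,\mathbb R): D^T\Omega+\Omega D=0\}$. **Theorem.** Let $M\in M(2n-1,\mathbb R)$ with $n\ge 2$, let $Q\in M(r,\mathbb R)$ with $r\ge 1$, and let $c$ be a real eigenvalue of $M$ with $c\notin\operatorname{spec}(Q)$. (I) If $c=0$, $m_0>1$ is odd and $M=M(0)\oplus Q$, then $\mathfrak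 g_M$ admits a symplectic structure if and only if $\mathfrak g_{M(0)}$ admits a symplectic structure and $Q\in\mathfrak{sp}_\Omega(r,\mathbb R)$ for some non-singular skew-symmetric $\Omega\in M(r,\mathbb R)$. (II) If $c\ne 0$, $M=M_c\oplus Q$ with $M_c=M(c)\oplus M(-c)$, $m_{-c}=m_c-1$ and $-c\notin\operatorname{spec}(Q)$, then $\mathfrak g_M$ admits a symplectic structure if and only if $\mathfrak g_{M_c}$ admits a symplectic structure and $Q\in\mathfrak{sp}_\Omega(r,\mathbb R)$ for some non-singular skew-symmetric $\Omega\in M(r,\mathbb R)$. (III) If $M=M(c)\oplus Q$, $m_c=1$ and $-c\notin\operatorname{spec}(Q)$, then $\mathfrak g_M$ admits a symplectic structure if and only if $Q\in\mathfrak{sp}_\Omega(r,\mathbb R)$ for some non-singular skew-symmetric $\Omega\in M(r,\mathbb R)$. -/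

import Mathlib

namespace AlmostAbelian

open Matrix

variable {ι κ : Type*}

/-- The set of distinct (complex) eigenvalues of a real square matrix. -/
def spec [Fintype ι] [DecidableEq ι] (C : Matrix ι ι ℝ) : Set ℂ :=
  spectrum ℂ (C.map (algebraMap ℝ ℂ))

/-- The set of distinct real eigenvalues of a real square matrix. -/
def specReal [Fintype ι] [DecidableEq ι] (C : Matrix ι ι ℝ) : Set ℝ :=
  spectrum ℝ C

/-- `M_a(r, ℝ)`: the real `r × r` matrices whose only (complex) eigenvalue is the real number `a`.
-/
def singleEigenvalue (a : ℝ) (r : ℕ) : Set (Matrix (Fin r) (Fin r) ℝ) :=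
  {C | spec C = {(a : ℂ)}}

/-- The block diagonal matrix `A ⊕ B`. -/
def directSum (A : Matrix ι ι ℝ) (B : Matrix κ κ ℝ) : Matrix (ι ⊕ κ) (ι ⊕ κ) ℝ :=
  Matrix.fromBlocks A 0 0 B

/-- `M` is the matrix `N`, after some renumbering `e` of the coordinates. It serves to compare a
block diagonal matrix, whose index type is a disjoint union, with one indexed by `Fin d`; the usual
numbering (first block first) is one possible choice of `e`. -/
def SameUpToNumbering (M : Matrix ι ι ℝ) (N : Matrix κ κ ℝ) : Prop :=
  ∃ e : κ ≃ ι, M = Matrix.reindex e e N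

/-- `𝔰𝔭_Ω`: the real matrices `D` with `Dᵀ Ω + Ω D = 0`. -/
def spOmega [Fintype ι] (Ω : Matrix ι ι ℝ) : Set (Matrix ι ι ℝ) :=
  {D | Dᵀ * Ω + Ω * D = 0}

/-- `Q` lies in `𝔰𝔭_Ω` for some non-singular skew-symmetric `Ω`. -/
def InSomeSp [Fintype ι] [DecidableEq ι] (Q : Matrix ι ι ℝ) : Prop :=
  ∃ Ω : Matrix ι ι ℝ, IsUnit Ω.det ∧ Ωᵀ = -Ω ∧ Q ∈ spOmega Ω

/-- The almost abelian Lie algebra `𝔤_A = ℝ e₀ ⋉_A ℝ^ι`: its element `⟨s, v⟩` stands for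
`s e₀ + v`, and the bracket, defined below, is determined by `[e₀, v] = A v` and `[v, w] = 0`. -/
@[ext]
structure LieAlg (A : Matrix ι ι ℝ) where
  /-- the coefficient of `e₀` -/
  fst : ℝ
  /-- the component in the abelian ideal `ℝ^ι` -/
  snd : ι → ℝ

namespace LieAlg

/-- The identification of the underlying set of `𝔤_A` with `ℝ × ℝ^ι`. -/
def equivProd (A : Matrix ι ι ℝ) : LieAlg A ≃ ℝ × (ι → ℝ) where
  toFun x := (x.fst, x.snd)
  invFun p := ⟨p.1, p.2⟩
  left_inv _ := rfl
  right_inv _ := rfl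

noncomputable instance (A : Matrix ι ι ℝ) : AddCommGroup (LieAlg A) :=
  (equivProd A).addCommGroup

noncomputable instance (A : Matrix ι ι ℝ) : Module ℝ (LieAlg A) :=
  (equivProd A).module ℝ

section

variable (A : Matrix ι ι ℝ) (t : ℝ) (x y : LieAlg A)

@[simp] theorem fst_zero : (0 : LieAlg A).fst = 0 := rfl
@[simp] theorem snd_zero : (0 : LieAlg A).snd = 0 := rfl
@[simp] theorem fst_add : (x + y).fst = x.fst + y.fst := rfl
@[simp] theorem snd_add : (x + y).snd = x.snd + y.snd := rfl
@[simp] theorem fst_smul : (t • x).fst = t * x.fst := rfl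
@[simp] theorem snd_smul : (t • x).snd = t • x.snd := rfl

end

/-- `[s e₀ + v, t e₀ + w] = s A w - t A v`. -/
noncomputable instance [Fintype ι] (A : Matrix ι ι ℝ) : Bracket (LieAlg A) (LieAlg A) where
  bracket x y := ⟨0, x.fst • (A *ᵥ y.snd) - y.fst • (A *ᵥ x.snd)⟩

@[simp] theorem fst_lie [Fintype ι] (A : Matrix ι ι ℝ) (x y : LieAlg A) : ⁅x, y⁆.fst = 0 := rfl

@[simp] theorem snd_lie [Fintype ι] (A : Matrix ι ι ℝ) (x y : LieAlg A) :
    ⁅x, y⁆.snd = x.fst • (A *ᵥ y.snd) - y.fst • (A *ᵥ x.snd) := rfl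

noncomputable instance [Fintype ι] (A : Matrix ι ι ℝ) : LieRing (LieAlg A) where
  add_lie x y z := by
    apply LieAlg.ext
    · simp
    · simp only [snd_lie, snd_add, fst_add, Matrix.mulVec_add]
      module
  lie_add x y z := by
    apply LieAlg.ext
    · simp
    · simp only [snd_lie, snd_add, fst_add, Matrix.mulVec_add]
      module
  lie_self x := by
    apply LieAlg.ext
    · simp
    · simp
  leibniz_lie x y z := by
    apply LieAlg.ext
    · simp
    · simp only [snd_lie, snd_add, fst_lie, Matrix.mulVec_sub, Matrix.mulVec_smul]
      module

noncomputable instance [Fintype ι] (A : Matrix ι ι ℝ) : LieAlgebra ℝ (LieAlg A) where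
  lie_smul t x y := by
    apply LieAlg.ext
    · simp
    · simp only [snd_lie, snd_smul, fst_smul, Matrix.mulVec_smul]
      module

end LieAlg

/-- A symplectic structure on a real Lie algebra: a non-degenerate alternating bilinear form `ω`
with `dω(x, y, z) = -ω([x, y], z) - ω([y, z], x) - ω([z, x], y) = 0`. -/
structure IsSymplectic {L : Type*} [LieRing L] [LieAlgebra ℝ L]
    (ω : LinearMap.BilinForm ℝ L) : Prop where
  alt : ω.IsAlt
  nondegenerate : ω.Nondegenerate
  closed : ∀ x y z : L, -ω ⁅x, y⁆ z - ω ⁅y, z⁆ x - ω ⁅z, x⁆ y = 0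

/-- The real Lie algebra `L` admits a symplectic structure. -/
def AdmitsSymplectic (L : Type*) [LieRing L] [LieAlgebra ℝ L] : Prop :=
  ∃ ω : LinearMap.BilinForm ℝ L, IsSymplectic ω

end AlmostAbelian

namespace AlmostAbelian

open Matrix

/-! ### Sylvester equations with disjoint spectra -/

section Intertwining

variable {ι κ : Type*} [Fintype ι] [DecidableEq ι] [Fintype κ] [DecidableEq κ]

/-! A symplectic form on `𝔤_A` is `e⁰ ∧ f + W`, where closedness says `A ∈ spOmega W` and
non-degeneracy says that `W` is singular with `ker W ∩ ker f = 0`; thus `ker W` is a line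
(`admitsSymplectic_iff`).

For `A ⊕ Q` with `spec A` disjoint from `-spec Q`, the off-diagonal block of `W` solves the
Sylvester equation `Aᵀ X + X Q = 0`, hence vanishes, and `W = W₁ ⊕ W₂`. If `A` has odd size, the
skew block `W₁` is singular and already uses up the kernel line, so `W₂` is non-singular and `Q`
preserves it (`admitsSymplectic_directSum_iff`). The three cases take `A` to be `M(0)`, `M(c) ⊕
M(-c)` and the `1 × 1` block `M(c)`. -/

theorem aeval_mul_of_intertwine {C : Matrix ι ι ℂ} {D : Matrix κ κ ℂ} {X : Matrix ι κ ℂ}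
    (h : C * X = X * D) (p : Polynomial ℂ) :
    Polynomial.aeval C p * X = X * Polynomial.aeval D p := by
  induction p using Polynomial.induction_on' with
  | add p q hp hq => simp [Matrix.add_mul, Matrix.mul_add, hp, hq]
  | monomial k a =>
    have hk : C ^ k * X = X * D ^ k := by
      induction k with
      | zero => simp
      | succ k ih =>
        rw [pow_succ, pow_succ', Matrix.mul_assoc, h, ← Matrix.mul_assoc, ih, Matrix.mul_assoc]
        rw [← pow_succ, ← pow_succ']
    simp [Polynomial.aeval_monomial, Algebra.algebraMap_eq_smul_one, hk]

/-- An intertwiner between complex matrices with disjoint spectra vanishes. -/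
theorem eq_zero_of_intertwine {C : Matrix ι ι ℂ} {D : Matrix κ κ ℂ} {X : Matrix ι κ ℂ}
    (h : C * X = X * D) (hd : ∀ z ∈ spectrum ℂ C, z ∉ spectrum ℂ D) : X = 0 := by
  -- Spectral mapping below needs a characteristic polynomial of positive degree.
  cases isEmpty_or_nonempty ι
  · exact Subsingleton.elim _ _
  -- With `p` the characteristic polynomial of `C`, the eigenvalues of `p(D)` are the `p(z)` for `z`
  -- an eigenvalue of `D`, none of them zero; Cayley–Hamilton gives `X p(D) = p(C) X = 0`.
  have hu : IsUnit (Polynomial.aeval D C.charpoly) := by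
    rw [← spectrum.zero_notMem_iff ℂ, spectrum.map_polynomial_aeval_of_degree_pos]
    · rintro ⟨z, hz, h0⟩
      exact hd z (Matrix.mem_spectrum_iff_isRoot_charpoly.2 h0) hz
    · rw [Matrix.charpoly_degree_eq_dim]
      exact_mod_cast Fintype.card_pos
  have h0 : X * Polynomial.aeval D C.charpoly = 0 := by
    rw [← aeval_mul_of_intertwine h, Matrix.aeval_self_charpoly, Matrix.zero_mul]
  obtain ⟨u, hu⟩ := hu
  rw [← hu] at h0
  simpa [Matrix.mul_assoc] using congrArg (· * (↑u⁻¹ : Matrix κ κ ℂ)) h0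

theorem eq_zero_of_transpose_mul_add_mul {A : Matrix ι ι ℝ} {Q : Matrix κ κ ℝ}
    {X : Matrix ι κ ℝ} (h : Aᵀ * X + X * Q = 0) (hd : ∀ z ∈ spec A, -z ∉ spec Q) : X = 0 := by
  have hX : X.map (algebraMap ℝ ℂ) = 0 := by
    refine eq_zero_of_intertwine (C := (A.map (algebraMap ℝ ℂ))ᵀ)
      (D := -Q.map (algebraMap ℝ ℂ)) ?_ fun z hz hz' => ?_
    · have := congrArg (fun Y => Y.map (algebraMap ℝ ℂ)) h
      simp only [Matrix.map_add _ (map_add (algebraMap ℝ ℂ)), Matrix.map_mul,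
        Matrix.map_zero _ (map_zero _)] at this
      rw [← Matrix.transpose_map, Matrix.mul_neg]
      exact eq_neg_of_add_eq_zero_left this
    · refine hd z ?_ ?_
      · rw [Matrix.mem_spectrum_iff_isRoot_charpoly, Matrix.charpoly_transpose] at hz
        exact Matrix.mem_spectrum_iff_isRoot_charpoly.2 hz
      · rw [← spectrum.neg_eq, Set.mem_neg] at hz'
        exact hz'
  ext i j
  simpa using congrFun (congrFun hX i) j

theorem spec_directSum (A : Matrix ι ι ℝ) (B : Matrix κ κ ℝ) :
    spec (directSum A B) = spec A ∪ spec B := by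
  ext z
  simp only [spec, directSum, Matrix.fromBlocks_map, Set.mem_union,
    Matrix.mem_spectrum_iff_isRoot_charpoly, Matrix.map_zero _ (map_zero (algebraMap ℝ ℂ)),
    Matrix.charpoly_fromBlocks_zero₁₂, Polynomial.root_mul]

end Intertwining

/-! ### Symplectic forms on `𝔤_A` in matrix terms -/

section Criterion

variable {ι κ : Type*} [Fintype ι] [Fintype κ]

theorem vecMul_of_skew {W : Matrix ι ι ℝ} (h : Wᵀ = -W) (v : ι → ℝ) : v ᵥ* W = -(W *ᵥ v) := by
  rw [← Matrix.mulVec_transpose, h, Matrix.neg_mulVec]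

theorem dotProduct_mulVec_self_of_skew {W : Matrix ι ι ℝ} (h : Wᵀ = -W) (v : ι → ℝ) :
    v ⬝ᵥ W *ᵥ v = 0 := by
  have : v ⬝ᵥ W *ᵥ v = -(v ⬝ᵥ W *ᵥ v) := by
    conv_lhs => rw [Matrix.dotProduct_mulVec, vecMul_of_skew h, neg_dotProduct, dotProduct_comm]
  linarith

/-- The bilinear form `e⁰ ∧ f + W` on `𝔤_A`. -/
noncomputable def pairForm (A W : Matrix ι ι ℝ) (f : ι → ℝ) : LinearMap.BilinForm ℝ (LieAlg A) :=
  LinearMap.mk₂ ℝ (fun x y => x.fst * (f ⬝ᵥ y.snd) - y.fst * (f ⬝ᵥ x.snd) + x.snd ⬝ᵥ W *ᵥ y.snd)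
    (fun x y z => by simp [dotProduct_add, add_dotProduct]; ring)
    (fun t x y => by simp [dotProduct_smul, smul_dotProduct]; ring)
    (fun x y z => by simp [dotProduct_add, Matrix.mulVec_add]; ring)
    (fun t x y => by simp [dotProduct_smul, Matrix.mulVec_smul]; ring)

theorem pairForm_apply (A W : Matrix ι ι ℝ) (f : ι → ℝ) (x y : LieAlg A) :
    pairForm A W f x y =
      x.fst * (f ⬝ᵥ y.snd) - y.fst * (f ⬝ᵥ x.snd) + x.snd ⬝ᵥ W *ᵥ y.snd := rfl

/-- The inclusion of the abelian ideal `ℝ^ι` into `𝔤_A`. -/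
noncomputable def LieAlg.incl (A : Matrix ι ι ℝ) : (ι → ℝ) →ₗ[ℝ] LieAlg A where
  toFun v := ⟨0, v⟩
  map_add' v w := LieAlg.ext (by simp) (by simp)
  map_smul' t v := LieAlg.ext (by simp) (by simp)

theorem fromBlocks_mem_spOmega_iff {A : Matrix ι ι ℝ} {Q : Matrix κ κ ℝ} {W₁ : Matrix ι ι ℝ}
    {X : Matrix ι κ ℝ} {Y : Matrix κ ι ℝ} {W₂ : Matrix κ κ ℝ} :
    directSum A Q ∈ spOmega (Matrix.fromBlocks W₁ X Y W₂) ↔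
      A ∈ spOmega W₁ ∧ Aᵀ * X + X * Q = 0 ∧ Qᵀ * Y + Y * A = 0 ∧ Q ∈ spOmega W₂ := by
  simp only [spOmega, directSum, Set.mem_ofPred_eq, Matrix.fromBlocks_transpose,
    Matrix.fromBlocks_multiply, Matrix.fromBlocks_add]
  rw [← Matrix.fromBlocks_zero, Matrix.fromBlocks_inj]
  simp

variable [DecidableEq ι] [DecidableEq κ]

/-- Data of a symplectic form `e⁰ ∧ f + W` on `𝔤_A`, in matrix terms. -/
structure IsSymplecticPair (A W : Matrix ι ι ℝ) (f : ι → ℝ) : Prop where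
  skew : Wᵀ = -W
  mem_sp : A ∈ spOmega W
  det_eq_zero : W.det = 0
  eq_zero : ∀ v, W *ᵥ v = 0 → f ⬝ᵥ v = 0 → v = 0

theorem det_eq_zero_of_skew_of_odd {W : Matrix ι ι ℝ} (h : Wᵀ = -W)
    (ho : Odd (Fintype.card ι)) : W.det = 0 := by
  have := W.det_transpose
  rw [h, Matrix.det_neg, ho.neg_one_pow] at this
  linarith

theorem mem_spOmega_iff {A W : Matrix ι ι ℝ} :
    A ∈ spOmega W ↔ ∀ v w, (A *ᵥ v) ⬝ᵥ W *ᵥ w + v ⬝ᵥ W *ᵥ (A *ᵥ w) = 0 := by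
  have key : ∀ v w, (A *ᵥ v) ⬝ᵥ W *ᵥ w + v ⬝ᵥ W *ᵥ (A *ᵥ w) = v ⬝ᵥ (Aᵀ * W + W * A) *ᵥ w := by
    intro v w
    rw [Matrix.add_mulVec, dotProduct_add, ← Matrix.mulVec_mulVec, ← Matrix.mulVec_mulVec,
      Matrix.dotProduct_mulVec v Aᵀ, Matrix.vecMul_transpose]
  simp only [key]
  constructor
  · intro h v w
    rw [show Aᵀ * W + W * A = 0 from h]
    simp
  · intro h
    change Aᵀ * W + W * A = 0
    ext i j
    simpa using h (Pi.single i 1) (Pi.single j 1)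

theorem IsSymplecticPair.isSymplectic {A W : Matrix ι ι ℝ} {f : ι → ℝ}
    (h : IsSymplecticPair A W f) : IsSymplectic (pairForm A W f) := by
  have halt : (pairForm A W f).IsAlt := fun x => by
    simp [pairForm_apply, dotProduct_mulVec_self_of_skew h.skew]
  refine ⟨halt, ?_, fun x y z => ?_⟩
  · refine (LinearMap.IsRefl.nondegenerate_iff_separatingLeft halt.isRefl).2 fun x hx => ?_
    -- For `x` in the radical, pairing with a kernel vector `u` of `W` kills the `e₀`-coefficient,
    -- pairing with `e₀` gives `f ⬝ᵥ x.snd = 0`, and pairing with the ideal gives `W *ᵥ x.snd = 0`.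
    obtain ⟨u, hu0, hu⟩ := Matrix.exists_mulVec_eq_zero_iff.2 h.det_eq_zero
    have hfu : f ⬝ᵥ u ≠ 0 := fun h0 => hu0 (h.eq_zero u hu h0)
    have hs : x.fst = 0 := by
      have := hx ⟨0, u⟩
      simpa [pairForm_apply, hu, hfu] using this
    have hf : f ⬝ᵥ x.snd = 0 := by
      have := hx ⟨1, 0⟩
      simpa [pairForm_apply] using this
    have hW : W *ᵥ x.snd = 0 := by
      have : x.snd ᵥ* W = 0 := by
        refine dotProduct_eq_zero _ fun w => ?_
        have := hx ⟨0, w⟩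
        simpa [pairForm_apply, hs, Matrix.dotProduct_mulVec] using this
      rw [vecMul_of_skew h.skew] at this
      simpa using this
    exact LieAlg.ext hs (h.eq_zero _ hW hf)
  · have hs : ∀ v w, v ⬝ᵥ W *ᵥ w = -(w ⬝ᵥ W *ᵥ v) := fun v w => by
      rw [Matrix.dotProduct_mulVec, vecMul_of_skew h.skew, neg_dotProduct, dotProduct_comm]
    have hm := mem_spOmega_iff.1 h.mem_sp
    have h1 := hm x.snd y.snd
    have h2 := hm y.snd z.snd
    have h3 := hm z.snd x.snd
    rw [hs x.snd] at h1
    rw [hs y.snd] at h2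
    rw [hs z.snd] at h3
    simp only [pairForm_apply, LieAlg.fst_lie, LieAlg.snd_lie, sub_dotProduct, smul_dotProduct,
      dotProduct_sub, dotProduct_smul, smul_eq_mul]
    linear_combination -z.fst * h1 - x.fst * h2 - y.fst * h3

theorem IsSymplectic.exists_isSymplecticPair {A : Matrix ι ι ℝ}
    {ω : LinearMap.BilinForm ℝ (LieAlg A)} (h : IsSymplectic ω) :
    ∃ W f, IsSymplecticPair A W f := by
  let e₀ : LieAlg A := ⟨1, 0⟩
  let W : Matrix ι ι ℝ := LinearMap.BilinForm.toMatrix' (ω.compl₁₂ (LieAlg.incl A) (LieAlg.incl A))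
  let f : ι → ℝ := fun i => ω e₀ (LieAlg.incl A (Pi.single i 1))
  have hW : ∀ v w, ω (LieAlg.incl A v) (LieAlg.incl A w) = v ⬝ᵥ W *ᵥ w := fun v w => by
    rw [← Matrix.toBilin'_apply', Matrix.toBilin'_toMatrix']
    rfl
  have hf : ∀ w, ω e₀ (LieAlg.incl A w) = f ⬝ᵥ w := fun w => by
    conv_lhs => rw [pi_eq_sum_univ' w]
    simp [f, dotProduct, mul_comm]
  have hx : ∀ x : LieAlg A, x = x.fst • e₀ + LieAlg.incl A x.snd := fun x =>
    LieAlg.ext (by simp [e₀, LieAlg.incl]) (by simp [e₀, LieAlg.incl])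
  have hneg : ∀ x y, ω x y = -ω y x := fun x y => (h.alt.neg_eq y x).symm
  have hskew : Wᵀ = -W := by
    ext i j
    have := hneg (LieAlg.incl A (Pi.single j 1)) (LieAlg.incl A (Pi.single i 1))
    simpa [hW] using this
  have hnd : ∀ s v, (∀ w, s * (f ⬝ᵥ w) + v ⬝ᵥ W *ᵥ w = 0) → f ⬝ᵥ v = 0 → s = 0 ∧ v = 0 := by
    intro s v h1 h2
    have h0 : s • e₀ + LieAlg.incl A v = 0 := by
      refine h.nondegenerate.1 _ fun y => ?_
      rw [hx y]
      have h3 := hneg (LieAlg.incl A v) e₀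
      rw [hf] at h3
      simp only [map_add, map_smul, LinearMap.add_apply, LinearMap.smul_apply, smul_eq_mul,
        h.alt.self_eq_zero, hf, hW, h3]
      linear_combination h1 y.snd - y.fst * h2
    constructor
    · simpa [e₀, LieAlg.incl] using congrArg LieAlg.fst h0
    · simpa [e₀, LieAlg.incl] using congrArg LieAlg.snd h0
  refine ⟨W, f, hskew, ?_, ?_, ?_⟩
  -- Closedness at `(e₀, v, w)` is the `spOmega` condition, because `[v, w] = 0`.
  · refine mem_spOmega_iff.2 fun v w => ?_
    have hb : ∀ u, ⁅e₀, LieAlg.incl A u⁆ = LieAlg.incl A (A *ᵥ u) := fun u =>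
      LieAlg.ext rfl (by simp [e₀, LieAlg.incl])
    have hb' : ⁅LieAlg.incl A v, LieAlg.incl A w⁆ = 0 :=
      LieAlg.ext rfl (by simp [LieAlg.incl])
    have := h.closed e₀ (LieAlg.incl A v) (LieAlg.incl A w)
    rw [hb, hb', ← lie_skew, hb, map_neg, LinearMap.neg_apply, hneg (LieAlg.incl A (A *ᵥ w)), hW,
      hW] at this
    simp only [map_zero, LinearMap.zero_apply] at this
    linarith
  -- If `W` were invertible, `e₀ + W⁻¹ f` would lie in the radical of `ω`.
  · by_contra hdet
    have hu : IsUnit W.det := isUnit_iff_ne_zero.2 hdet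
    let v : ι → ℝ := W⁻¹ *ᵥ f
    have hv : W *ᵥ v = f := by
      simp [v, Matrix.mul_nonsing_inv W hu]
    refine one_ne_zero (hnd 1 v (fun w => ?_) ?_).1
    · rw [Matrix.dotProduct_mulVec, vecMul_of_skew hskew, hv]
      simp
    · rw [← hv, dotProduct_comm, dotProduct_mulVec_self_of_skew hskew]
  · intro v hv hfv
    refine (hnd 0 v (fun w => ?_) hfv).2
    rw [Matrix.dotProduct_mulVec, vecMul_of_skew hskew, hv]
    simp

theorem admitsSymplectic_iff {A : Matrix ι ι ℝ} :
    AdmitsSymplectic (LieAlg A) ↔ ∃ W f, IsSymplecticPair A W f :=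
  ⟨fun ⟨_, h⟩ => h.exists_isSymplecticPair, fun ⟨_, _, h⟩ => ⟨_, h.isSymplectic⟩⟩

theorem IsSymplecticPair.reindex {A W : Matrix ι ι ℝ} {f : ι → ℝ} (h : IsSymplecticPair A W f)
    (e : ι ≃ κ) :
    IsSymplecticPair (Matrix.reindex e e A) (Matrix.reindex e e W) (f ∘ e.symm) where
  skew := by
    rw [Matrix.transpose_reindex, h.skew]
    rfl
  mem_sp := by
    have h0 : Aᵀ * W + W * A = 0 := h.mem_sp
    change (Matrix.reindex e e A)ᵀ * Matrix.reindex e e W +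
      Matrix.reindex e e W * Matrix.reindex e e A = 0
    simp only [Matrix.reindex_apply, Matrix.transpose_submatrix, Matrix.submatrix_mul_equiv]
    exact congrArg (fun Y => Y.submatrix e.symm e.symm) h0
  det_eq_zero := by rw [Matrix.det_reindex_self, h.det_eq_zero]
  eq_zero v hv hf := by
    rw [Matrix.reindex_apply, Matrix.submatrix_mulVec_equiv, Equiv.symm_symm] at hv
    rw [comp_equiv_symm_dotProduct] at hf
    have h0 : v ∘ e = 0 := by
      refine h.eq_zero _ ?_ hf
      ext i
      simpa using congrFun hv (e i)
    ext j
    simpa using congrFun h0 (e.symm j)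

theorem SameUpToNumbering.admitsSymplectic_iff {M : Matrix ι ι ℝ} {N : Matrix κ κ ℝ}
    (h : SameUpToNumbering M N) :
    AdmitsSymplectic (LieAlg M) ↔ AdmitsSymplectic (LieAlg N) := by
  obtain ⟨e, rfl⟩ := h
  rw [AlmostAbelian.admitsSymplectic_iff, AlmostAbelian.admitsSymplectic_iff]
  refine ⟨fun ⟨W, f, h⟩ => ⟨Matrix.reindex e.symm e.symm W, f ∘ e, ?_⟩,
    fun ⟨W, f, h⟩ => ⟨_, _, h.reindex e⟩⟩
  simpa using h.reindex e.symm

theorem admitsSymplectic_directSum_iff {A : Matrix ι ι ℝ} {Q : Matrix κ κ ℝ}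
    (ho : Odd (Fintype.card ι)) (hd : ∀ z ∈ spec A, -z ∉ spec Q) :
    AdmitsSymplectic (LieAlg (directSum A Q)) ↔ AdmitsSymplectic (LieAlg A) ∧ InSomeSp Q := by
  rw [admitsSymplectic_iff, admitsSymplectic_iff]
  constructor
  · rintro ⟨W, f, h⟩
    obtain ⟨W₁, X, Y, W₂, rfl⟩ : ∃ W₁ X Y W₂, W = Matrix.fromBlocks W₁ X Y W₂ :=
      ⟨_, _, _, _, W.fromBlocks_toBlocks.symm⟩
    have hs := h.skew
    rw [Matrix.fromBlocks_transpose, Matrix.fromBlocks_neg, Matrix.fromBlocks_inj] at hs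
    obtain ⟨hs₁, hYX, -, hs₂⟩ := hs
    obtain ⟨hA, hX, -, hQ⟩ := fromBlocks_mem_spOmega_iff.1 h.mem_sp
    obtain rfl := eq_zero_of_transpose_mul_add_mul hX hd
    obtain rfl : Y = 0 := by simpa using hYX
    have hdet := det_eq_zero_of_skew_of_odd hs₁ ho
    have hinj : ∀ v₁ v₂, W₁ *ᵥ v₁ = 0 → W₂ *ᵥ v₂ = 0 →
        (f ∘ Sum.inl) ⬝ᵥ v₁ + (f ∘ Sum.inr) ⬝ᵥ v₂ = 0 → v₁ = 0 ∧ v₂ = 0 := by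
      intro v₁ v₂ h₁ h₂ h₃
      have h0 := h.eq_zero (Sum.elim v₁ v₂)
        (by rw [Matrix.fromBlocks_mulVec]; ext (i | i) <;> simp [h₁, h₂])
        (by simpa [dotProduct] using h₃)
      exact ⟨funext fun i => congrFun h0 (Sum.inl i), funext fun i => congrFun h0 (Sum.inr i)⟩
    have hinj₁ : ∀ v, W₁ *ᵥ v = 0 → (f ∘ Sum.inl) ⬝ᵥ v = 0 → v = 0 := fun v hv hf =>
      (hinj v 0 hv (by simp) (by simpa using hf)).1
    refine ⟨⟨W₁, f ∘ Sum.inl, hs₁, hA, hdet, hinj₁⟩, W₂, isUnit_iff_ne_zero.2 fun h₂ => ?_,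
      hs₂, hQ⟩
    obtain ⟨u, hu0, hu⟩ := Matrix.exists_mulVec_eq_zero_iff.2 hdet
    obtain ⟨v, hv0, hv⟩ := Matrix.exists_mulVec_eq_zero_iff.2 h₂
    have hfu : (f ∘ Sum.inl) ⬝ᵥ u ≠ 0 := fun h0 => hu0 (hinj₁ u hu h0)
    -- The multiple of `u` is chosen so that `f` vanishes on the sum of the two kernel vectors; a
    -- second kernel direction, from `W₂`, is thus impossible.
    refine hv0 (hinj (-(((f ∘ Sum.inr) ⬝ᵥ v) / ((f ∘ Sum.inl) ⬝ᵥ u)) • u) v ?_ hv ?_).2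
    · rw [Matrix.mulVec_smul, hu, smul_zero]
    · rw [dotProduct_smul, smul_eq_mul]
      field_simp
      ring
  · rintro ⟨⟨W, f, h⟩, Ω, hΩ, hskew, hQ⟩
    refine ⟨Matrix.fromBlocks W 0 0 Ω, Sum.elim f 0, ?_, ?_, ?_, fun v hv hf => ?_⟩
    · simp [Matrix.fromBlocks_transpose, Matrix.fromBlocks_neg, h.skew, hskew]
    · exact fromBlocks_mem_spOmega_iff.2 ⟨h.mem_sp, by simp, by simp, hQ⟩
    · rw [Matrix.det_fromBlocks_zero₂₁, h.det_eq_zero, zero_mul]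
    · rw [Matrix.fromBlocks_mulVec] at hv
      have h₁ : v ∘ Sum.inl = 0 := by
        refine h.eq_zero _ ?_ (by simpa [dotProduct] using hf)
        ext i
        simpa using congrFun hv (Sum.inl i)
      have h₂ : v ∘ Sum.inr = 0 := by
        by_contra h0
        refine hΩ.ne_zero (Matrix.exists_mulVec_eq_zero_iff.1 ⟨v ∘ Sum.inr, h0, ?_⟩)
        ext i
        simpa using congrFun hv (Sum.inr i)
      ext (i | i)
      · exact congrFun h₁ i
      · exact congrFun h₂ i

/-- Here `𝔤_A` is two-dimensional, so the area form `e⁰ ∧ e¹` is automatically closed. -/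
theorem admitsSymplectic_of_unique [Unique ι] (A : Matrix ι ι ℝ) :
    AdmitsSymplectic (LieAlg A) := by
  refine admitsSymplectic_iff.2 ⟨0, 1, by simp, by simp [spOmega], by simp, fun v _ hf => ?_⟩
  ext i
  simpa [dotProduct, Unique.eq_default i] using hf

end Criterion

end AlmostAbelian

open AlmostAbelian in
theorem theorem5p18 (n : ℕ) (hn : 2 ≤ n) (r : ℕ) (hr : 1 ≤ r)
    (M : Matrix (Fin (2 * n - 1)) (Fin (2 * n - 1)) ℝ)
    (Q : Matrix (Fin r) (Fin r) ℝ)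
    (c : ℝ) (hcM : c ∈ specReal M) (hcQ : (c : ℂ) ∉ spec Q)
    -- the block `M(c)`, of size `m = m_c`
    (m : ℕ) (Mc : Matrix (Fin m) (Fin m) ℝ) (hMc : Mc ∈ singleEigenvalue c m) :
    -- (I)
    (c = 0 → 1 < m → Odd m → SameUpToNumbering M (directSum Mc Q) →
      (AdmitsSymplectic (LieAlg M) ↔ AdmitsSymplectic (LieAlg Mc) ∧ InSomeSp Q)) ∧
    -- (II), with the block `M(-c)` of size `m' = m_{-c}`
    (c ≠ 0 → ∀ (m' : ℕ) (Mc' : Matrix (Fin m') (Fin m') ℝ), Mc' ∈ singleEigenvalue (-c) m' →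
      m' + 1 = m → ((-c : ℝ) : ℂ) ∉ spec Q →
      SameUpToNumbering M (directSum (directSum Mc Mc') Q) →
      (AdmitsSymplectic (LieAlg M) ↔
        AdmitsSymplectic (LieAlg (directSum Mc Mc')) ∧ InSomeSp Q)) ∧
    -- (III)
    (m = 1 → ((-c : ℝ) : ℂ) ∉ spec Q → SameUpToNumbering M (directSum Mc Q) →
      (AdmitsSymplectic (LieAlg M) ↔ InSomeSp Q)) := by
  have hMc : spec Mc = {(c : ℂ)} := hMc
  refine ⟨fun hc _ hm hM => ?_, fun hc m' Mc' hMc' hm hQ' hM => ?_, fun hm hQ' hM => ?_⟩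
  · refine hM.admitsSymplectic_iff.trans (admitsSymplectic_directSum_iff (by simpa using hm) ?_)
    rw [hMc]
    rintro z rfl
    subst hc
    simpa using hcQ
  · have hMc' : spec Mc' = {((-c : ℝ) : ℂ)} := hMc'
    have hm' : m' ≠ 0 := by
      rintro rfl
      have : ((-c : ℝ) : ℂ) ∈ spec Mc' := by rw [hMc']; rfl
      exact this (isUnit_of_subsingleton _)
    refine hM.admitsSymplectic_iff.trans (admitsSymplectic_directSum_iff ?_ ?_)
    · rw [Fintype.card_sum, Fintype.card_fin, Fintype.card_fin]
      -- The combined size is `m_c + m_{-c} = 2 m' + 1`.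
      exact ⟨m', by omega⟩
    · rw [spec_directSum, hMc, hMc']
      rintro z (rfl | rfl)
      · simpa using hQ'
      · simpa using hcQ
  · subst hm
    refine hM.admitsSymplectic_iff.trans
      ((admitsSymplectic_directSum_iff (by simp) ?_).trans
        (and_iff_right (admitsSymplectic_of_unique Mc)))
    rw [hMc]
    rintro z rfl
    simpa using hQ'
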